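/- \textbf{Setting.} Let $AP$ be a countable set of propositional variables, enumerated injectively by an initial segment of $\mathbb N$ (so $AP=\{p_0,p_1,\dots\}$, finite or infinite). Propositional formulas are generated by $\varphi ::= p \mid \lnot\varphi \mid \varphi\lor\varphi$ with $p\in AP$, and $\varphi\land\psi=\lnot(\lnot\varphi\lor\lnot\psi)$, $\varphi\to\psi=\lnot\varphi\lor\psi$. A \emph{SLEEC rule} $\sigma$ is an expression \[ \text{IF } C_0 \text{ THEN } O_0,\ \text{UNLESS } C_1 \text{ IN WHICH CASE } O_1,\ \dots,\ \text{UNLESS } C_n \text{ IN WHICH CASE } O_n \] where $n\ge 0$ and the $C_i,O_i$ are propositional formulas over $AP$. Its compilation is \[ \mathrm{compile}(\sigma)=\Bigl[\bigwedge_{0\le i\le n-1}\bigl((C_0\land\dots\land C_i\land\lnot C_{i+1})\to O_i\bigr)\Bigr]\land\Bigl[(C_0\land\dots\land C_n)\to O_n\Bigr], \] the first bracket being absent when $n=0$. A finite set $\Gamma$ of SLEEC rules \emph{entails} a formula $\varphi$ if every interpretation $v:AP\to\{\mathrm{true},\mathrm{false}\}$ that makes $\mathrm{compile}(\sigma)$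 true for all $\sigma\in\Gamma$ makes $\varphi$ true. \textbf{Proposition.} The following problem is in PTIME. Input: a finite set $\Gamma$ of SLEEC rules over $AP$ in each of which every $C_i$ is a negative literal $\lnot p$ and every $O_i$ is a positive literal $p$ (with $p\in AP$), and an obligation $o\in AP$. Question: does $\Gamma$ entail $o$? Here $\Gamma$ (as a list of rules) and $o$ are written as a word over a fixed finite alphabet, a variable $p_k$ being written as the binary numeral of $k$. The proposition says that the set of words that encode an input with these restrictions and with answer ``yes'' is decided by a deterministic Turing machine in time polynomial in the length of the word. -/

import Mathlib

namespace SLEEC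

/-- Propositional formulas over a set `AP` of variables: `φ ::= p | ¬ φ | φ ∨ φ`. -/
inductive Formula (AP : Type*) where
  | var (p : AP) : Formula AP
  | neg (φ : Formula AP) : Formula AP
  | or (φ ψ : Formula AP) : Formula AP

namespace Formula

variable {AP : Type*}

/-- `φ ∧ ψ = ¬ (¬ φ ∨ ¬ ψ)`. -/
def and (φ ψ : Formula AP) : Formula AP := neg (or (neg φ) (neg ψ))

/-- `φ → ψ = ¬ φ ∨ ψ`. -/
def imp (φ ψ : Formula AP) : Formula AP := or (neg φ) ψ

/-- The truth value of a formula under an interpretation `v : AP → {true, false}`. -/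
def eval (v : AP → Bool) : Formula AP → Bool
  | var p => v p
  | neg φ => !(φ.eval v)
  | or φ ψ => φ.eval v || ψ.eval v

/-- Positive literals `p`. -/
def IsPosLiteral (φ : Formula AP) : Prop := ∃ p : AP, φ = var p

/-- Negative literals `¬ p`. -/
def IsNegLiteral (φ : Formula AP) : Prop := ∃ p : AP, φ = neg (var p)

end Formula

/-- `Φ ⊨ φ`: every interpretation that satisfies all formulas of `Φ` satisfies `φ`. -/
def Entails {AP : Type*} (Φ : Set (Formula AP)) (φ : Formula AP) : Prop :=
  ∀ v : AP → Bool, (∀ ψ ∈ Φ, ψ.eval v = true) → φ.eval v = true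

/-- A SLEEC rule: IF `C₀` THEN `O₀`, UNLESS `C₁` IN WHICH CASE `O₁`, …,
UNLESS `Cₙ` IN WHICH CASE `Oₙ`. The field `exceptions` is the list
`[(C₁, O₁), …, (Cₙ, Oₙ)]`; it is empty when `n = 0`. -/
structure Rule (AP : Type*) where
  C₀ : Formula AP
  O₀ : Formula AP
  exceptions : List (Formula AP × Formula AP)

namespace Rule

variable {AP : Type*}

/-- The terms `C₀, …, Cₙ` of a rule. -/
def conditions (σ : Rule AP) : List (Formula AP) := σ.C₀ :: σ.exceptions.map Prod.fst

/-- The terms `O₀, …, Oₙ` of a rule. -/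
def obligations (σ : Rule AP) : List (Formula AP) := σ.O₀ :: σ.exceptions.map Prod.snd

/-- With `K = C₀ ∧ … ∧ Cᵢ`, `O = Oᵢ` and the list `[(Cᵢ₊₁, Oᵢ₊₁), …, (Cₙ, Oₙ)]`, this is the
conjunction of `C₀ ∧ … ∧ Cⱼ ∧ ¬ Cⱼ₊₁ → Oⱼ` for `i ≤ j < n` and of `C₀ ∧ … ∧ Cₙ → Oₙ`. -/
def compileFrom (K O : Formula AP) : List (Formula AP × Formula AP) → Formula AP
  | [] => K.imp O
  | (C', O') :: rest => ((K.and C'.neg).imp O).and (compileFrom (K.and C') O' rest)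

/-- The compilation of a rule into propositional logic:
`⋀_{0 ≤ i < n} (C₀ ∧ … ∧ Cᵢ ∧ ¬ Cᵢ₊₁ → Oᵢ) ∧ (C₀ ∧ … ∧ Cₙ → Oₙ)`. -/
def compile (σ : Rule AP) : Formula AP := compileFrom σ.C₀ σ.O₀ σ.exceptions

/-- All the `Cᵢ` are negative literals and all the `Oᵢ` are positive literals. -/
def IsNegPos (σ : Rule AP) : Prop :=
  (∀ C ∈ σ.conditions, C.IsNegLiteral) ∧ (∀ O ∈ σ.obligations, O.IsPosLiteral)

end Rule

/-- A (finite) set `Γ` of SLEEC rules, given by a list of its elements, entails `φ`. -/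
def RulesEntail {AP : Type*} (Γ : List (Rule AP)) (φ : Formula AP) : Prop :=
  Entails {ψ | ∃ σ ∈ Γ, ψ = σ.compile} φ

/-- The finite alphabet in which inputs are written. -/
inductive Token where
  | bit (b : Bool)
  | var
  | neg
  | or
  | kwIf
  | kwThen
  | kwUnless
  | kwInWhichCase
  | turnstile
  deriving DecidableEq, Fintype

section Encode

variable {AP : Type*} (index : AP → ℕ)

/-- Prefix (Polish) notation; a variable is written as `var` followed by its index in binary. -/
def encodeFormula : Formula AP → List Token
  | .var p => Token.var :: (Computability.encodeNat (index p)).map Token.bit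
  | .neg φ => Token.neg :: encodeFormula φ
  | .or φ ψ => Token.or :: (encodeFormula φ ++ encodeFormula ψ)

/-- `IF C₀ THEN O₀ UNLESS C₁ IN-WHICH-CASE O₁ … UNLESS Cₙ IN-WHICH-CASE Oₙ`. -/
def encodeRule (σ : Rule AP) : List Token :=
  Token.kwIf :: encodeFormula index σ.C₀ ++
    Token.kwThen :: encodeFormula index σ.O₀ ++
    σ.exceptions.flatMap fun e =>
      Token.kwUnless :: encodeFormula index e.1 ++
        Token.kwInWhichCase :: encodeFormula index e.2

/-- The rules of `Γ` one after the other, then `⊨ o`. -/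
def encodeInstance (Γ : List (Rule AP)) (o : AP) : List Token :=
  Γ.flatMap (encodeRule index) ++ Token.turnstile :: encodeFormula index (.var o)

/-- The entailment problem for SLEEC rules whose conditions are negative literals and whose
obligations are positive literals, as a formal language: the words that encode a finite set `Γ` of
such rules and a variable `o` with `Γ ⊨ o`. -/
def negPosEntailment : Language Token :=
  {w | ∃ (Γ : List (Rule AP)) (o : AP), (∀ σ ∈ Γ, σ.IsNegPos) ∧ RulesEntail Γ (.var o) ∧
    w = encodeInstance index Γ o}

end Encode

/-- The class PTIME: the languages over an alphabet `α` that are decided by a deterministic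
(multi-stack) Turing machine in time polynomial in the length of the input word. The machine model
makes `α` finite. -/
def PTIME (α : Type) : Set (Language α) :=
  {L | ∃ f : List α → Bool, (∀ w, f w = true ↔ w ∈ L) ∧
    Nonempty (Turing.TM2ComputableInPolyTime (id : List α → List α) Computability.encodeBool f)}

end SLEEC

/-!
Why the entailment problem for rules with negative conditions and positive obligations is in PTIME.

The compilation of a rule with conditions `¬ pᵢ` and obligations `qᵢ` is equivalent to the clauses
`p₀ ∨ … ∨ pᵢ ∨ ¬ pᵢ₊₁ ∨ qᵢ` and `p₀ ∨ … ∨ pₙ ∨ qₙ`, which have at most one negative literal. Hence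
`Γ ⊨ o` can be decided by unit propagation from the assumption that `o` is false. Let `F` be a set
of variables known to be false in every model of `Γ` in which `o` is false. If all positive
variables of a clause are in `F`, then so may be the variable `pᵢ₊₁` of its negative literal; if
there is no such literal, then there is no such model, and `Γ ⊨ o` (`Search.sound_run`). If neither
happens and `o ∈ F`, then the interpretation that makes exactly the variables of `F` false is a
countermodel (`Search.complete_run`). Since `F` grows in each round and contains only `o` and
variables of conditions, there are at most linearly many rounds.

A round needs only finite memory and one pass in each direction over the input word, in which the
occurrences of the variables in `F` are marked. A pass from left to right looks for a violated rule
or a variable to be added to `F`, and writes the numeral of that variable on a stack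
(`Scan.tracks_run`). A pass from right to left meets the digits of each occurrence of a variable
before its token `var`, and so can mark the occurrences with the same numeral (`marksTo_instance`).
These passes are loops of a machine with five stacks, and together with the number of rounds they
give a cubic time bound (`within_rounds`, `within_main`).

It remains to reject the words that do not encode an instance. The set of indices of variables is a
lower set, so it is finite or everything, and the numerals of variables form a regular language
(`isRegular_range_numeral`). Negative conditions and positive obligations leave no nesting of
formulas, so that the encodings of instances are regular too (`mem_accepts_syntaxDFA`), and an
automaton checks the syntax while the input is read.
-/

namespace SLEEC

variable {AP : Type*}

/-! ### Rules with negative conditions and positive obligations -/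

/-- The pair `((p₀, q₀), [(p₁, q₁), …])` describes the rule with the conditions `¬ pᵢ` and the
obligations `qᵢ`. -/
abbrev RuleData (AP : Type*) := (AP × AP) × List (AP × AP)

/-- The rule `IF ¬ p₀ THEN q₀ UNLESS ¬ p₁ IN WHICH CASE q₁ …` described by
`r = ((p₀, q₀), [(p₁, q₁), …])`. -/
def negPosRule (r : RuleData AP) : Rule AP where
  C₀ := .neg (.var r.1.1)
  O₀ := .var r.1.2
  exceptions := r.2.map fun e => (.neg (.var e.1), .var e.2)

theorem isNegPos_negPosRule (r : RuleData AP) : (negPosRule r).IsNegPos := by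
  constructor
  · intro C hC
    simp only [Rule.conditions, negPosRule, List.map_map, List.mem_cons, List.mem_map] at hC
    obtain rfl | ⟨e, _, rfl⟩ := hC
    exacts [⟨_, rfl⟩, ⟨_, rfl⟩]
  · intro O hO
    simp only [Rule.obligations, negPosRule, List.map_map, List.mem_cons, List.mem_map] at hO
    obtain rfl | ⟨e, _, rfl⟩ := hO
    exacts [⟨_, rfl⟩, ⟨_, rfl⟩]

theorem exists_map_eq_of_forall {l : List (Formula AP × Formula AP)}
    (hC : ∀ C ∈ l.map Prod.fst, C.IsNegLiteral) (hO : ∀ O ∈ l.map Prod.snd, O.IsPosLiteral) :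
    ∃ m : List (AP × AP), l = m.map fun e => (.neg (.var e.1), .var e.2) := by
  induction l with
  | nil => exact ⟨[], rfl⟩
  | cons x l ih =>
    simp only [List.map_cons, List.forall_mem_cons] at hC hO
    obtain ⟨⟨p, hp⟩, hC⟩ := hC
    obtain ⟨⟨q, hq⟩, hO⟩ := hO
    obtain ⟨m, rfl⟩ := ih hC hO
    exact ⟨(p, q) :: m, by simp [← hp, ← hq]⟩

theorem Rule.IsNegPos.exists_eq {σ : Rule AP} (h : σ.IsNegPos) : ∃ r, negPosRule r = σ := by
  obtain ⟨C, O, l⟩ := σ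
  obtain ⟨hC, hO⟩ := h
  simp only [Rule.conditions, Rule.obligations, List.forall_mem_cons] at hC hO
  obtain ⟨⟨p, rfl⟩, hC⟩ := hC
  obtain ⟨⟨q, rfl⟩, hO⟩ := hO
  obtain ⟨m, rfl⟩ := exists_map_eq_of_forall hC hO
  exact ⟨((p, q), m), rfl⟩

theorem exists_map_negPosRule {Γ : List (Rule AP)} (h : ∀ σ ∈ Γ, σ.IsNegPos) :
    ∃ R : List (RuleData AP), Γ = R.map negPosRule := by
  induction Γ with
  | nil => exact ⟨[], rfl⟩
  | cons σ Γ ih =>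
    simp only [List.forall_mem_cons] at h
    obtain ⟨R, rfl⟩ := ih h.2
    obtain ⟨r, rfl⟩ := h.1.exists_eq
    exact ⟨r :: R, rfl⟩

/-! ### Propagating falsity through the rules -/

/-- The state of a pass through a list of rules that looks for a consequence of the assumption that
certain variables are false. While the pass is inside a rule, `pre` says that all conditions
`¬ p₀, …, ¬ pᵢ` met so far are known to hold, and `hit` that moreover the last obligation `qᵢ` is
known to fail; the rule then forces the next condition `¬ pᵢ₊₁` to hold, or is violated if there is
none. The first new variable forced to be false is kept in `found`, and `contra` records that a
rule is violated. -/
structure Search (AP : Type*) where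
  found : Option AP
  contra : Bool
  pre : Bool
  hit : Bool

namespace Search

/-- The initial state of a pass. -/
def init : Search AP := ⟨none, false, false, false⟩

/-- Meeting the variable of a condition, when the variables in `F` are known to be false. -/
def condition (F : AP → Bool) (A : Search AP) (p : AP) : Search AP :=
  { A with
    found := A.found.or (if A.hit && !F p then some p else none)
    pre := A.pre && F p
    hit := false }

/-- Reading one pair `(pᵢ, qᵢ)` of a rule. -/
def pair (F : AP → Bool) (A : Search AP) (e : AP × AP) : Search AP :=
  { A.condition F e.1 with hit := A.pre && F e.1 && F e.2 }

/-- Leaving a rule, which is violated if `hit` is still set. -/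
def close (A : Search AP) (hit : Bool) : Search AP :=
  { A with contra := A.contra || A.hit, pre := true, hit := hit }

/-- Reading one rule. -/
def rule (F : AP → Bool) (A : Search AP) (r : RuleData AP) : Search AP :=
  (r.1 :: r.2).foldl (pair F) (A.close false)

/-- Reading the rules `R` and the goal `o`, which is assumed to be false: it is found if it is not
yet in `F` and no rule provides another variable. -/
def run (F : AP → Bool) (R : List (RuleData AP)) (o : AP) : Search AP :=
  ((R.foldl (rule F) init).close true).condition F o

variable {F : AP → Bool} {v : AP → Bool}

/-- The invariant of a pass for an interpretation `v` in which the variables of `F` are false: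
what was found is false too, and no rule was seen to be violated. -/
def Sound (F v : AP → Bool) (A : Search AP) : Prop :=
  (∀ p, A.found = some p → F p = false ∧ v p = false) ∧ A.contra = false

theorem Sound.condition {A : Search AP} (h : A.Sound F v) {p : AP}
    (hp : A.hit = true → v p = false) : (A.condition F p).Sound F v := by
  obtain ⟨f, c, pre, hit⟩ := A
  refine ⟨fun x hx => ?_, h.2⟩
  rcases f with _ | y
  · simp only [Search.condition, Option.none_or] at hx
    split_ifs at hx with hc
    cases hx
    simp only [Bool.and_eq_true, Bool.not_eq_true'] at hc
    exact ⟨hc.2, hp hc.1⟩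
  · exact h.1 x (by simpa [Search.condition] using hx)

theorem sound_foldl_pair (hF : ∀ p, F p = true → v p = false) (l : List (AP × AP)) :
    ∀ (K : Formula AP) (q : AP) (A : Search AP), A.Sound F v →
      (A.pre = true → K.eval v = true) →
      (A.hit = true → K.eval v = true ∧ v q = false) →
      (Rule.compileFrom K (.var q) (l.map fun e => (.neg (.var e.1), .var e.2))).eval v = true →
      (l.foldl (pair F) A).Sound F v ∧ (l.foldl (pair F) A).hit = false := by
  induction l with
  | nil =>
    intro K q A hA _ hhit hc
    refine ⟨hA, Bool.eq_false_iff.2 fun h => ?_⟩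
    obtain ⟨h1, h2⟩ := hhit h
    simp [Rule.compileFrom, Formula.imp, Formula.eval, h1, h2] at hc
  | cons e l ih =>
    intro K q A hA hpre hhit hc
    simp only [List.map_cons, Rule.compileFrom, Formula.and, Formula.imp, Formula.eval,
      Bool.not_or, Bool.not_not, Bool.and_eq_true] at hc
    obtain ⟨hc1, hc2⟩ := hc
    have hs : (A.condition F e.1).Sound F v := hA.condition fun h => by
      obtain ⟨h1, h2⟩ := hhit h
      simpa [h1, h2] using hc1
    refine ih (K.and (.neg (.var e.1))) e.2 (pair F A e) hs ?_ ?_ hc2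
    · intro h
      simp only [pair, Search.condition, Bool.and_eq_true] at h
      simp [Formula.and, Formula.eval, hpre h.1, hF _ h.2]
    · intro h
      simp only [pair, Bool.and_eq_true] at h
      simp [Formula.and, Formula.eval, hpre h.1.1, hF _ h.1.2, hF _ h.2]

theorem Sound.rule (hF : ∀ p, F p = true → v p = false) {A : Search AP} (hA : A.Sound F v)
    (hhit : A.hit = false) {r : RuleData AP}
    (hr : (negPosRule r).compile.eval v = true) :
    (A.rule F r).Sound F v ∧ (A.rule F r).hit = false := by
  have hcl : (A.close false).Sound F v := ⟨hA.1, by simp [close, hhit, hA.2]⟩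
  refine sound_foldl_pair hF r.2 (.neg (.var r.1.1)) r.1.2 _
    (hcl.condition (p := r.1.1) (by simp [close])) ?_ ?_ hr
  · intro h
    simp only [pair, Search.condition, close, Bool.true_and] at h
    simp [Formula.eval, hF _ h]
  · intro h
    simp only [pair, close, Bool.true_and, Bool.and_eq_true] at h
    simp [Formula.eval, hF _ h.1, hF _ h.2]

/-- In a model of the rules in which the goal and all of `F` are false, no rule is violated, and a
variable that a pass finds is false. -/
theorem sound_run (hF : ∀ p, F p = true → v p = false)
    {R : List (RuleData AP)} {o : AP}
    (hR : ∀ r ∈ R, (negPosRule r).compile.eval v = true) (ho : v o = false) :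
    (run F R o).Sound F v := by
  have key : ∀ (R : List (RuleData AP)) (A : Search AP),
      (∀ r ∈ R, (negPosRule r).compile.eval v = true) → A.Sound F v → A.hit = false →
      (R.foldl (Search.rule F) A).Sound F v ∧ (R.foldl (Search.rule F) A).hit = false := by
    intro R
    induction R with
    | nil => exact fun A _ h h' => ⟨h, h'⟩
    | cons r R ih =>
      intro A hR hA hhit
      obtain ⟨h1, h2⟩ := hA.rule hF hhit (hR r (by simp))
      exact ih _ (fun r hr => hR r (by simp [hr])) h1 h2
  obtain ⟨h1, h2⟩ := key R init hR ⟨by simp [init], rfl⟩ rfl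
  exact Sound.condition (A := (R.foldl (Search.rule F) init).close true)
    ⟨h1.1, by simp [close, h1.2, h2]⟩ fun _ => ho

theorem found_eq_none_of_condition {A : Search AP} {p : AP}
    (h : (A.condition F p).found = none) :
    A.found = none ∧ (A.hit = true → F p = true) := by
  simpa [Search.condition, Option.or_eq_none_iff] using h

theorem found_eq_none_of_foldl_pair {l : List (AP × AP)} {A : Search AP}
    (h : (l.foldl (pair F) A).found = none) : A.found = none := by
  induction l generalizing A with
  | nil => exact h
  | cons e l ih => exact (found_eq_none_of_condition (p := e.1) (ih (A := pair F A e) h)).1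

theorem contra_foldl_pair (l : List (AP × AP)) (A : Search AP) :
    (l.foldl (pair F) A).contra = A.contra := by
  induction l generalizing A with
  | nil => rfl
  | cons e l ih => exact ih _

theorem complete_foldl_pair (l : List (AP × AP)) :
    ∀ (K : Formula AP) (q : AP) (A : Search AP), A.pre = K.eval (fun p => !F p) →
      A.hit = (A.pre && F q) → (l.foldl (pair F) A).found = none →
      (l.foldl (pair F) A).hit = false →
      (Rule.compileFrom K (.var q) (l.map fun e => (.neg (.var e.1), .var e.2))).eval
        (fun p => !F p) = true := by
  induction l with
  | nil =>
    intro K q A hpre hhit _ h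
    simp only [List.foldl_nil] at h
    rw [hhit, hpre] at h
    cases hk : K.eval (fun p => !F p) <;>
      simp_all [Rule.compileFrom, Formula.imp, Formula.eval]
  | cons e l ih =>
    intro K q A hpre hhit hfound h
    have h1 := ih (K.and (.neg (.var e.1))) e.2 (pair F A e)
      (by simp [pair, Search.condition, hpre, Formula.and, Formula.eval])
      (by simp [pair, Search.condition]) hfound h
    have h2 := (found_eq_none_of_condition (p := e.1)
      (found_eq_none_of_foldl_pair (A := pair F A e) hfound)).2
    rw [hhit, hpre] at h2
    simp only [List.map_cons, Rule.compileFrom]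
    generalize Rule.compileFrom _ _ _ = φ at h1 ⊢
    simp only [Formula.and, Formula.imp, Formula.eval, h1]
    revert h2
    cases K.eval (fun p => !F p) <;> cases F q <;> cases F e.1 <;> simp

theorem complete_rule {A : Search AP} {r : RuleData AP}
    (hfound : (A.rule F r).found = none) (hhit : (A.rule F r).hit = false) :
    A.found = none ∧ (negPosRule r).compile.eval (fun p => !F p) = true := by
  refine ⟨found_eq_none_of_foldl_pair (A := A.close false) hfound, ?_⟩
  exact complete_foldl_pair r.2 (.neg (.var r.1.1)) r.1.2 (pair F (A.close false) r.1)
    (by simp [pair, Search.condition, close, Formula.eval])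
    (by simp [pair, Search.condition, close]) hfound hhit

/-- If a pass finds nothing, then making exactly the variables of `F` false satisfies all rules and
falsifies the goal. -/
theorem complete_run {R : List (RuleData AP)} {o : AP}
    (hfound : (run F R o).found = none) (hcontra : (run F R o).contra = false) :
    (∀ r ∈ R, (negPosRule r).compile.eval (fun p => !F p) = true) ∧ F o = true := by
  have key : ∀ (R : List (RuleData AP)) (A : Search AP),
      (R.foldl (Search.rule F) A).found = none → (R.foldl (Search.rule F) A).contra = false →
      (R.foldl (Search.rule F) A).hit = false →
      A.found = none ∧ A.contra = false ∧ A.hit = false ∧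
        ∀ r ∈ R, (negPosRule r).compile.eval (fun p => !F p) = true := by
    intro R
    induction R with
    | nil => exact fun A h1 h2 h3 => ⟨h1, h2, h3, by simp⟩
    | cons r R ih =>
      intro A h1 h2 h3
      obtain ⟨h4, h5, h6, h7⟩ := ih _ h1 h2 h3
      obtain ⟨h8, h9⟩ := complete_rule h4 h6
      rw [Search.rule, contra_foldl_pair] at h5
      simp only [close, Bool.or_eq_false_iff] at h5
      exact ⟨h8, h5.1, h5.2, List.forall_mem_cons.2 ⟨h9, h7⟩⟩
  obtain ⟨h1, h2⟩ := found_eq_none_of_condition hfound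
  simp only [run, Search.condition, close, Bool.or_eq_false_iff] at hcontra
  exact ⟨(key R init h1 hcontra.1 hcontra.2).2.2.2, h2 rfl⟩

/-- The variables of the conditions of `R`, and the goal `o`. -/
def candidates (R : List (RuleData AP)) (o : AP) : List AP :=
  o :: R.flatMap fun r => (r.1 :: r.2).map Prod.fst

theorem condition_found_mem {W : List AP} {A : Search AP} {p : AP}
    (hA : ∀ x, A.found = some x → x ∈ W ∧ F x = false) (hp : p ∈ W) :
    ∀ x, (A.condition F p).found = some x → x ∈ W ∧ F x = false := by
  intro x hx
  simp only [Search.condition, Option.or_eq_some_iff] at hx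
  rcases hx with hx | ⟨_, hx⟩
  · exact hA x hx
  · split_ifs at hx with h
    cases hx
    simp only [Bool.and_eq_true, Bool.not_eq_true'] at h
    exact ⟨hp, h.2⟩

theorem foldl_pair_found_mem {W : List AP} {l : List (AP × AP)} {A : Search AP}
    (hA : ∀ x, A.found = some x → x ∈ W ∧ F x = false) (hl : ∀ e ∈ l, e.1 ∈ W) :
    ∀ x, (l.foldl (pair F) A).found = some x → x ∈ W ∧ F x = false := by
  induction l generalizing A with
  | nil => exact hA
  | cons e l ih =>
    exact ih (A := pair F A e) (condition_found_mem hA (hl e (by simp)))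
      fun e he => hl e (by simp [he])

theorem run_found_mem {R : List (RuleData AP)} {o p : AP}
    (h : (run F R o).found = some p) : p ∈ candidates R o ∧ F p = false := by
  have key : ∀ (W : List AP) (R : List (RuleData AP)) (A : Search AP),
      (∀ r ∈ R, ∀ e ∈ r.1 :: r.2, e.1 ∈ W) →
      (∀ x, A.found = some x → x ∈ W ∧ F x = false) →
      ∀ x, (R.foldl (Search.rule F) A).found = some x → x ∈ W ∧ F x = false := by
    intro W R
    induction R with
    | nil => exact fun A _ h => h
    | cons r R ih =>
      intro A hR hA
      exact ih _ (fun r hr => hR r (by simp [hr]))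
        (foldl_pair_found_mem (A := A.close false) hA (hR r (by simp)))
  refine condition_found_mem (A := (R.foldl (Search.rule F) init).close true)
    (key (candidates R o) R init ?_ (by simp [init])) (by simp [candidates]) p h
  intro r hr e he
  refine List.mem_cons_of_mem _ (List.mem_flatMap.2 ⟨r, hr, List.mem_map.2 ⟨e, he, rfl⟩⟩)

end Search

end SLEEC

namespace SLEEC

variable {AP : Type*}

/-! ### Words with marked variables -/

section Marked

variable (index : AP → ℕ)

/-- The binary numeral that names a variable. -/
def numeral (p : AP) : List Bool := Computability.encodeNat (index p)

theorem numeral_injective (hindex : Function.Injective index) :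
    Function.Injective (numeral index) := fun _ _ h =>
  hindex (by simpa [numeral] using congrArg Computability.decodeNat h)

/-- An occurrence of `p`; the token `var` carries the mark `F p`. All other tokens carry the mark
`false`. -/
def markedVar (F : AP → Bool) (p : AP) : List (Token × Bool) :=
  (.var, F p) :: (numeral index p).map fun b => (.bit b, false)

/-- The keyword `k₁`, the condition `¬ p`, the keyword `k₂` and the obligation `q`, where
`e = (p, q)`. -/
def markedPair (F : AP → Bool) (k₁ k₂ : Token) (e : AP × AP) : List (Token × Bool) :=
  [(k₁, false), (.neg, false)] ++ markedVar index F e.1 ++ [(k₂, false)] ++ markedVar index F e.2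

/-- The marked encoding of a rule. -/
def markedRule (F : AP → Bool) (r : RuleData AP) : List (Token × Bool) :=
  markedPair index F .kwIf .kwThen r.1 ++
    r.2.flatMap (markedPair index F .kwUnless .kwInWhichCase)

/-- The marked encoding of an instance of the entailment problem. -/
def markedInstance (F : AP → Bool) (R : List (RuleData AP)) (o : AP) :
    List (Token × Bool) :=
  R.flatMap (markedRule index F) ++ ([(.turnstile, false)] ++ markedVar index F o)

theorem map_fst_markedRule (F : AP → Bool) (r : RuleData AP) :
    (markedRule index F r).map Prod.fst = encodeRule index (negPosRule r) := by
  have hpair : ∀ (l : List (AP × AP)) k₁ k₂,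
      (l.flatMap (markedPair index F k₁ k₂)).map Prod.fst = l.flatMap fun e =>
        [k₁, .neg] ++ encodeFormula index (.var e.1) ++ [k₂] ++ encodeFormula index (.var e.2) := by
    intro l k₁ k₂
    simp [List.map_flatMap, markedPair, markedVar, numeral, encodeFormula, Function.comp_def]
  rw [markedRule, List.map_append, hpair]
  simp [encodeRule, markedPair, markedVar, numeral, negPosRule, encodeFormula, List.flatMap_map,
    Function.comp_def]

theorem map_fst_markedInstance (F : AP → Bool) (R : List (RuleData AP)) (o : AP) :
    (markedInstance index F R o).map Prod.fst = encodeInstance index (R.map negPosRule) o := by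
  simp [markedInstance, encodeInstance, map_fst_markedRule, markedVar, numeral, encodeFormula,
    List.flatMap_map, List.map_flatMap, Function.comp_def]

theorem markedInstance_false (R : List (RuleData AP)) (o : AP) :
    markedInstance index (fun _ => false) R o =
      (encodeInstance index (R.map negPosRule) o).map fun t => (t, false) := by
  rw [← map_fst_markedInstance index fun _ => false, List.map_map]
  refine (List.map_id'' (fun _ => rfl) _).symm.trans (List.map_congr_left fun t ht => ?_)
  suffices t.2 = false by rw [← this]; rfl
  simp only [markedInstance, markedRule, markedPair, markedVar, List.mem_append, List.mem_flatMap,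
    List.mem_cons, List.mem_map, List.not_mem_nil, or_false] at ht
  aesop

theorem length_candidates_le (R : List (RuleData AP)) (o : AP) :
    (Search.candidates R o).length ≤ (encodeInstance index (R.map negPosRule) o).length := by
  rw [← map_fst_markedInstance index fun _ => false]
  have hpair : ∀ k₁ k₂ (l : List (AP × AP)),
      l.length ≤ (l.flatMap (markedPair index (fun _ => false) k₁ k₂)).length := by
    intro k₁ k₂ l
    induction l with
    | nil => simp
    | cons e l ih => simp [markedPair, markedVar] at ih ⊢; omega
  simp only [Search.candidates, markedInstance, List.length_map, List.length_append,
    List.length_cons, List.length_nil]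
  have : (R.flatMap fun r => (r.1 :: r.2).map Prod.fst).length ≤
      (R.flatMap (markedRule index fun _ => false)).length := by
    induction R with
    | nil => simp
    | cons r R ih =>
      have := hpair .kwUnless .kwInWhichCase r.2
      simp only [List.flatMap_cons, List.length_append, List.length_map, List.length_cons,
        markedRule, markedPair] at ih this ⊢
      omega
  omega

end Marked

/-! ### Scanning a marked word with finite memory -/

/-- The finite memory of a scan that performs `Search.run` on a marked word: the Boolean components
of the state of the search, whether a variable was found, whether the next variable is in a
condition (or is the goal) rather than in an obligation, and whether the numeral being read is the
one of the variable just found. -/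
structure Scan where
  found : Bool
  contra : Bool
  pre : Bool
  hit : Bool
  cond : Bool
  copying : Bool
  deriving Fintype

namespace Scan

/-- The memory at the beginning of a scan. -/
def init : Scan := ⟨false, false, false, false, false, false⟩

/-- The effect of reading a marked token. -/
def next (s : Scan) : Token × Bool → Scan
  | (.kwIf, _) =>
    { s with contra := s.contra || s.hit, pre := true, hit := false, cond := true,
             copying := false }
  | (.turnstile, _) =>
    { s with contra := s.contra || s.hit, pre := true, hit := true, cond := true, copying := false }
  | (.kwUnless, _) => { s with cond := true, copying := false }
  | (.kwThen, _) => { s with cond := false, copying := false }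
  | (.kwInWhichCase, _) => { s with cond := false, copying := false }
  | (.var, m) =>
    if s.cond then
      { s with
        found := s.found || (s.hit && !m)
        pre := s.pre && m
        hit := false
        copying := !s.found && (s.hit && !m) }
    else { s with hit := s.pre && m }
  | (.bit _, _) => s
  | (.neg, _) => s
  | (.or, _) => s

/-- A scan step together with its output: the digits of the variable found are pushed on the stack
`c`. -/
def step (x : Scan × List Bool) (t : Token × Bool) : Scan × List Bool :=
  (x.1.next t,
    match t with
    | (.bit b, _) => if x.1.copying then b :: x.2 else x.2
    | _ => x.2)

variable (index : AP → ℕ)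

/-- The memory and the output of a scan agree with a state of the search. -/
def Tracks (x : Scan × List Bool) (A : Search AP) : Prop :=
  x.1.found = A.found.isSome ∧ x.1.contra = A.contra ∧ x.1.pre = A.pre ∧ x.1.hit = A.hit ∧
    x.2 = (A.found.elim [] (numeral index)).reverse

theorem foldl_step_bits (l : List Bool) (s : Scan) (c : List Bool) :
    (l.map fun b => (Token.bit b, false)).foldl step (s, c) =
      (s, if s.copying then l.reverse ++ c else c) := by
  induction l generalizing c with
  | nil => simp
  | cons b l ih =>
    rw [List.map_cons, List.foldl_cons]
    simp only [step, next]
    rw [ih]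
    split_ifs <;> simp

variable {index} {F : AP → Bool}

theorem Tracks.condition {x : Scan × List Bool} {A : Search AP} (h : Tracks index x A)
    (hc : x.1.cond = true) (p : AP) :
    Tracks index ((markedVar index F p).foldl step x) (A.condition F p) := by
  obtain ⟨⟨f, co, pr, hi, cd, cp⟩, c⟩ := x
  obtain ⟨f', co', pr', hi'⟩ := A
  simp only [Tracks] at h hc
  obtain ⟨rfl, rfl, rfl, rfl, rfl⟩ := h
  subst hc
  simp only [markedVar, List.foldl_cons, step]
  rw [foldl_step_bits]
  cases f' <;> cases hi <;> cases hF : F p <;> simp [Tracks, next, Search.condition, hF]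

theorem Tracks.pair {x : Scan × List Bool} {A : Search AP} (h : Tracks index x A)
    (hc : x.1.cond = true) {k : Token} (hk : k = .kwThen ∨ k = .kwInWhichCase) (e : AP × AP) :
    Tracks index
      ((markedVar index F e.1 ++ [(k, false)] ++ markedVar index F e.2).foldl step x)
      (A.pair F e) := by
  rw [List.foldl_append, List.foldl_append]
  have h' := h.condition (F := F) hc e.1
  revert h'
  generalize (markedVar index F e.1).foldl step x = y
  obtain ⟨⟨f, co, pr, hi, cd, cp⟩, c⟩ := y
  rintro ⟨h1, h2, h3, h4, h5⟩
  simp only at h1 h2 h3 h4 h5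
  subst h1 h2 h3 h4 h5
  simp only [List.foldl_cons, List.foldl_nil, markedVar, step]
  rw [foldl_step_bits]
  rcases hk with rfl | rfl <;> simp [Tracks, next, Search.pair, Search.condition]

theorem Tracks.unless {x : Scan × List Bool} {A : Search AP} (h : Tracks index x A)
    (l : List (AP × AP)) :
    Tracks index ((l.flatMap (markedPair index F .kwUnless .kwInWhichCase)).foldl step x)
      (l.foldl (Search.pair F) A) := by
  induction l generalizing x A with
  | nil => exact h
  | cons e l ih =>
    rw [List.flatMap_cons, List.foldl_append, List.foldl_cons]
    refine ih ?_
    rw [markedPair, List.append_assoc, List.append_assoc, List.foldl_append, ← List.append_assoc]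
    exact Tracks.pair (x := Scan.step (Scan.step x (.kwUnless, false)) (.neg, false))
      h rfl (.inr rfl) e

theorem Tracks.rule {x : Scan × List Bool} {A : Search AP} (h : Tracks index x A)
    (r : RuleData AP) :
    Tracks index ((markedRule index F r).foldl step x) (A.rule F r) := by
  rw [markedRule, List.foldl_append, Search.rule, List.foldl_cons]
  refine Tracks.unless ?_ _
  rw [markedPair, List.append_assoc, List.append_assoc, List.foldl_append, ← List.append_assoc]
  refine Tracks.pair ?_ rfl (.inl rfl) r.1
  obtain ⟨h1, h2, h3, h4, h5⟩ := h
  simp [Tracks, step, next, Search.close, *]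

theorem tracks_run (R : List (RuleData AP)) (o : AP) :
    Tracks index ((markedInstance index F R o).foldl step (init, [])) (Search.run F R o) := by
  have key : ∀ (R : List (RuleData AP)) x (A : Search AP), Tracks index x A →
      Tracks index ((R.flatMap (markedRule index F)).foldl step x)
        (R.foldl (Search.rule F) A) := by
    intro R
    induction R with
    | nil => exact fun _ _ h => h
    | cons r R ih =>
      intro x A h
      rw [List.flatMap_cons, List.foldl_append]
      exact ih _ _ (h.rule r)
  rw [markedInstance, List.foldl_append, List.foldl_append, Search.run]
  obtain ⟨h1, h2, h3, h4, h5⟩ :=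
    key R (init, []) Search.init (by simp [Tracks, init, Search.init])
  refine Tracks.condition ?_ rfl o
  simp [Tracks, step, next, Search.close, *]

end Scan

end SLEEC

namespace SLEEC

open Computability

/-! ### The syntax of instances is regular -/

theorem exists_encodePosNum_eq (l : List Bool) : ∃ n, encodePosNum n = l ++ [true] := by
  induction l with
  | nil => exact ⟨.one, rfl⟩
  | cons b l ih =>
    obtain ⟨n, hn⟩ := ih
    cases b
    exacts [⟨.bit0 n, by simp [encodePosNum, hn]⟩, ⟨.bit1 n, by simp [encodePosNum, hn]⟩]

theorem exists_encodePosNum_eq_append (n : PosNum) : ∃ l, encodePosNum n = l ++ [true] := by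
  induction n with
  | one => exact ⟨[], rfl⟩
  | bit0 n ih => obtain ⟨l, hl⟩ := ih; exact ⟨false :: l, by simp [encodePosNum, hl]⟩
  | bit1 n ih => obtain ⟨l, hl⟩ := ih; exact ⟨true :: l, by simp [encodePosNum, hl]⟩

/-- A binary numeral is empty or ends in its leading digit `1`. -/
theorem mem_range_encodeNat {l : List Bool} :
    l ∈ Set.range encodeNat ↔ l = [] ∨ ∃ m, l = m ++ [true] := by
  constructor
  · rintro ⟨n, rfl⟩
    rw [encodeNat]
    cases (n : Num) with
    | zero => exact .inl rfl
    | pos n => exact .inr (exists_encodePosNum_eq_append n)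
  · rintro (rfl | ⟨m, rfl⟩)
    · exact ⟨0, rfl⟩
    · obtain ⟨n, hn⟩ := exists_encodePosNum_eq m
      refine ⟨((Num.pos n : Num) : ℕ), ?_⟩
      rw [encodeNat, Num.of_to_nat, ← hn, encodeNum]

theorem isRegular_range_encodeNat : Language.IsRegular (Set.range encodeNat) := by
  refine ⟨Bool, inferInstance, ⟨fun _ b => b, true, {true}⟩, ?_⟩
  ext l
  refine Iff.trans ?_ mem_range_encodeNat.symm
  induction l using List.reverseRecOn with
  | nil => exact ⟨fun _ => .inl rfl, fun _ => rfl⟩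
  | append_singleton l b _ =>
    rw [DFA.mem_accepts, DFA.eval_append_singleton]
    refine ⟨fun h => .inr ⟨l, by rw [show b = true from h]⟩, ?_⟩
    rintro (h | ⟨m, h⟩)
    · simp at h
    · exact List.singleton_inj.1 (List.append_inj' h rfl).2

/-- Every left quotient of a finite language consists of suffixes of its words, so that there are
only finitely many. -/
theorem isRegular_of_finite {α : Type} {L : Language α} (h : Set.Finite (L : Set (List α))) :
    L.IsRegular := by
  refine .of_finite_range_leftQuotient ?_
  have hs : Set.Finite {y : List α | ∃ x ∈ (L : Set (List α)), y <:+ x} := by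
    refine (h.biUnion fun x _ => (List.finite_toSet x.tails)).subset ?_
    rintro y ⟨x, hx, hy⟩
    exact Set.mem_biUnion hx (by simpa using hy)
  refine hs.finite_subsets.subset ?_
  rintro _ ⟨x, rfl⟩ y hy
  exact ⟨x ++ y, hy, List.suffix_append x y⟩

theorem isRegular_range_numeral {AP : Type*} (index : AP → ℕ)
    (hsegment : IsLowerSet (Set.range index)) :
    Language.IsRegular (Set.range (numeral index)) := by
  have hr : Set.range (numeral index) = encodeNat '' Set.range index := Set.range_comp _ _
  rcases (Set.range index).finite_or_infinite with h | h
  · exact isRegular_of_finite (hr ▸ h.image _)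
  · have : Set.range index = Set.univ :=
      Set.eq_univ_of_forall fun n => by
        obtain ⟨m, hm, hnm⟩ := h.exists_gt n
        exact hsegment hnm.le hm
    rw [hr, this, Set.image_univ]
    exact isRegular_range_encodeNat

/-- The states of an automaton that checks the syntax of instances: what has to come next, where
the states with `Num` are inside a numeral, with the state of an automaton for numerals. In the
states for conditions, the Boolean tells whether it is the first condition of a rule. -/
inductive Phase (Q : Type) where
  | rules
  | cond (first : Bool)
  | condVar (first : Bool)
  | condNum (first : Bool) (q : Q)
  | obl
  | oblNum (q : Q)
  | goal
  | goalNum (q : Q)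
  | dead
  deriving Fintype

open Classical in
/-- The automaton that checks the syntax of instances, built from an automaton `N` for the
numerals. -/
noncomputable def syntaxDFA {Q : Type} (N : DFA Bool Q) : DFA Token (Phase Q) where
  step
    | .rules, .kwIf => .cond true
    | .rules, .turnstile => .goal
    | .cond f, .neg => .condVar f
    | .condVar f, .var => .condNum f N.start
    | .condNum f q, .bit b => .condNum f (N.step q b)
    | .condNum true q, .kwThen => if q ∈ N.accept then .obl else .dead
    | .condNum false q, .kwInWhichCase => if q ∈ N.accept then .obl else .dead
    | .obl, .var => .oblNum N.start
    | .oblNum q, .bit b => .oblNum (N.step q b)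
    | .oblNum q, .kwUnless => if q ∈ N.accept then .cond false else .dead
    | .oblNum q, .kwIf => if q ∈ N.accept then .cond true else .dead
    | .oblNum q, .turnstile => if q ∈ N.accept then .goal else .dead
    | .goal, .var => .goalNum N.start
    | .goalNum q, .bit b => .goalNum (N.step q b)
    | _, _ => .dead
  start := .rules
  accept := {s | ∃ q ∈ N.accept, s = .goalNum q}

section Instances

variable {AP : Type*} (index : AP → ℕ) {Q : Type} (N : DFA Bool Q)

/-- The rest of a rule after one of its numerals, followed by further rules and the goal. -/
def encodeRest (l : List (AP × AP)) (R : List (RuleData AP)) (o : AP) :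
    List Token :=
  (l.flatMap fun e =>
    [.kwUnless, .neg] ++ (encodeFormula index (.var e.1) ++ (.kwInWhichCase ::
      encodeFormula index (.var e.2)))) ++ encodeInstance index (R.map negPosRule) o

theorem encodeInstance_cons (r : RuleData AP)
    (R : List (RuleData AP)) (o : AP) :
    encodeInstance index ((r :: R).map negPosRule) o =
      [.kwIf, .neg] ++ (encodeFormula index (.var r.1.1) ++ (.kwThen ::
        (encodeFormula index (.var r.1.2) ++ encodeRest index r.2 R o))) := by
  simp [encodeInstance, encodeRest, encodeRule, negPosRule, encodeFormula, List.flatMap_map]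

/-- The words that have to follow in each state of the syntax check. -/
def Phase.Follows : Phase Q → List Token → Prop
  | .rules, w => ∃ (R : List (RuleData AP)) (o : AP), w = encodeInstance index (R.map negPosRule) o
  | .cond f, w => ∃ p q l, ∃ (R : List (RuleData AP)) (o : AP),
      w = .neg :: (encodeFormula index (.var p) ++
        (if f then .kwThen else .kwInWhichCase) :: (encodeFormula index (.var q) ++
          encodeRest index l R o))
  | .condVar f, w => ∃ p q l, ∃ (R : List (RuleData AP)) (o : AP),
      w = encodeFormula index (.var p) ++
        (if f then .kwThen else .kwInWhichCase) :: (encodeFormula index (.var q) ++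
          encodeRest index l R o)
  | .condNum f s, w => ∃ m q l, ∃ (R : List (RuleData AP)) (o : AP),
      N.evalFrom s m ∈ N.accept ∧ w = m.map Token.bit ++
        (if f then .kwThen else .kwInWhichCase) :: (encodeFormula index (.var q) ++
          encodeRest index l R o)
  | .obl, w => ∃ q l, ∃ (R : List (RuleData AP)) (o : AP),
      w = encodeFormula index (.var q) ++ encodeRest index l R o
  | .oblNum s, w => ∃ m l, ∃ (R : List (RuleData AP)) (o : AP),
      N.evalFrom s m ∈ N.accept ∧ w = m.map Token.bit ++ encodeRest index l R o
  | .goal, w => ∃ o, w = encodeFormula index (.var o)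
  | .goalNum s, w => ∃ m, N.evalFrom s m ∈ N.accept ∧ w = m.map Token.bit
  | .dead, _ => False

variable {index N}

theorem evalFrom_dead (w : List Token) : (syntaxDFA N).evalFrom .dead w = .dead := by
  induction w with
  | nil => rfl
  | cons t w ih => rw [DFA.evalFrom_cons]; exact ih

/-- An automaton for the numerals ends in an accepting state exactly on the names of variables. -/
theorem exists_encodeFormula_eq (hN : N.accepts = Set.range (numeral index)) {m : List Bool}
    (hm : N.evalFrom N.start m ∈ N.accept) :
    ∃ p, Token.var :: m.map Token.bit = encodeFormula index (.var p) := by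
  have : m ∈ N.accepts := hm
  rw [hN] at this
  obtain ⟨p, rfl⟩ := this
  exact ⟨p, rfl⟩

/-- Every accepted word is a rest of an instance, by induction on the word: the rest after its first
token is known, and the token tells how that rest continues. -/
theorem follows_of_accepts (hN : N.accepts = Set.range (numeral index)) (w : List Token) :
    ∀ s : Phase Q, (syntaxDFA N).evalFrom s w ∈ (syntaxDFA N).accept → s.Follows index N w := by
  induction w with
  | nil =>
    rintro s ⟨q, hq, h⟩
    rw [DFA.evalFrom_nil] at h
    subst h
    exact ⟨[], hq, rfl⟩
  | cons t w ih =>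
    intro s h
    rw [DFA.evalFrom_cons] at h
    have hdead : (syntaxDFA N).step s t ≠ .dead := by
      rintro hd
      rw [hd, evalFrom_dead] at h
      obtain ⟨q, -, h⟩ := h
      cases h
    have := ih _ h
    clear h ih
    cases s with
    | rules =>
      cases t <;> first | exact absurd rfl hdead | skip
      · obtain ⟨p, q, l, R, o, rfl⟩ := this
        exact ⟨((p, q), l) :: R, o, by rw [encodeInstance_cons]; rfl⟩
      · obtain ⟨o, rfl⟩ := this
        exact ⟨[], o, rfl⟩
    | cond f =>
      cases t <;> first | exact absurd rfl hdead | skip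
      obtain ⟨p, q, l, R, o, rfl⟩ := this
      exact ⟨p, q, l, R, o, rfl⟩
    | condVar f =>
      cases t <;> first | exact absurd rfl hdead | skip
      obtain ⟨m, q, l, R, o, hm, rfl⟩ := this
      obtain ⟨p, hp⟩ := exists_encodeFormula_eq hN hm
      exact ⟨p, q, l, R, o, by rw [← hp]; rfl⟩
    | condNum f s =>
      by_cases hs : s ∈ N.accept
      · cases f <;> cases t <;> first | exact absurd rfl hdead | skip
        all_goals first
          | (obtain ⟨m, q, l, R, o, hm, rfl⟩ := this; exact ⟨_ :: m, q, l, R, o, hm, rfl⟩)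
          | (simp only [syntaxDFA, if_pos hs] at this
             obtain ⟨q, l, R, o, rfl⟩ := this
             exact ⟨[], q, l, R, o, hs, rfl⟩)
      · cases f <;> cases t <;>
          first | exact absurd rfl hdead | exact absurd (if_neg hs) hdead | skip
        all_goals obtain ⟨m, q, l, R, o, hm, rfl⟩ := this; exact ⟨_ :: m, q, l, R, o, hm, rfl⟩
    | obl =>
      cases t <;> first | exact absurd rfl hdead | skip
      obtain ⟨m, l, R, o, hm, rfl⟩ := this
      obtain ⟨p, hp⟩ := exists_encodeFormula_eq hN hm
      exact ⟨p, l, R, o, by rw [← hp]; rfl⟩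
    | oblNum s =>
      by_cases hs : s ∈ N.accept
      · cases t <;> first | exact absurd rfl hdead | skip
        · obtain ⟨m, l, R, o, hm, rfl⟩ := this
          exact ⟨_ :: m, l, R, o, hm, rfl⟩
        · simp only [syntaxDFA, if_pos hs] at this
          obtain ⟨p, q, l, R, o, rfl⟩ := this
          exact ⟨[], [], ((p, q), l) :: R, o, hs, by
            simp only [encodeRest]; rw [encodeInstance_cons]; rfl⟩
        · simp only [syntaxDFA, if_pos hs] at this
          obtain ⟨p, q, l, R, o, rfl⟩ := this
          exact ⟨[], (p, q) :: l, R, o, hs, by simp [encodeRest]⟩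
        · simp only [syntaxDFA, if_pos hs] at this
          obtain ⟨o, rfl⟩ := this
          exact ⟨[], [], [], o, hs, rfl⟩
      · cases t <;>
          first | exact absurd rfl hdead | exact absurd (if_neg hs) hdead | skip
        obtain ⟨m, l, R, o, hm, rfl⟩ := this
        exact ⟨_ :: m, l, R, o, hm, rfl⟩
    | goal =>
      cases t <;> first | exact absurd rfl hdead | skip
      obtain ⟨m, hm, rfl⟩ := this
      exact exists_encodeFormula_eq hN hm
    | goalNum s =>
      cases t <;> first | exact absurd rfl hdead | skip
      obtain ⟨m, hm, rfl⟩ := this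
      exact ⟨_ :: m, hm, rfl⟩
    | dead => exact absurd rfl hdead

theorem evalFrom_bits (c : Q → Phase Q)
    (hc : ∀ q b, (syntaxDFA N).step (c q) (.bit b) = c (N.step q b)) (m : List Bool) :
    ∀ q, (syntaxDFA N).evalFrom (c q) (m.map Token.bit) = c (N.evalFrom q m) := by
  induction m with
  | nil => exact fun _ => rfl
  | cons b m ih => intro q; rw [List.map_cons, DFA.evalFrom_cons, hc, ih]; rfl

theorem evalFrom_var (c : Q → Phase Q) (s : Phase Q)
    (hs : (syntaxDFA N).step s .var = c N.start)
    (hc : ∀ q b, (syntaxDFA N).step (c q) (.bit b) = c (N.step q b)) (p : AP) (w : List Token) :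
    (syntaxDFA N).evalFrom s (encodeFormula index (.var p) ++ w) =
      (syntaxDFA N).evalFrom (c (N.eval (numeral index p))) w := by
  rw [DFA.evalFrom_of_append, encodeFormula, DFA.evalFrom_cons, hs, evalFrom_bits c hc]
  rfl

theorem eval_mem_accept (hN : N.accepts = Set.range (numeral index)) (p : AP) :
    N.eval (numeral index p) ∈ N.accept := by
  have : numeral index p ∈ N.accepts := by rw [hN]; exact ⟨p, rfl⟩
  exact this

theorem evalFrom_goal (hN : N.accepts = Set.range (numeral index)) (o : AP) :
    (syntaxDFA N).evalFrom .goal (encodeFormula index (.var o)) ∈ (syntaxDFA N).accept := by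
  rw [← List.append_nil (encodeFormula index _),
    evalFrom_var .goalNum .goal rfl (fun _ _ => rfl)]
  exact ⟨_, eval_mem_accept hN o, rfl⟩

/-- From the first token of a condition, the automaton proceeds to the end of the obligation. -/
theorem evalFrom_pair (hN : N.accepts = Set.range (numeral index)) (f : Bool) (e : AP × AP)
    (w : List Token) :
    (syntaxDFA N).evalFrom (.cond f) (.neg :: (encodeFormula index (.var e.1) ++
      ((if f then .kwThen else .kwInWhichCase) :: (encodeFormula index (.var e.2) ++ w)))) =
      (syntaxDFA N).evalFrom (.oblNum (N.eval (numeral index e.2))) w := by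
  rw [DFA.evalFrom_cons]
  change (syntaxDFA N).evalFrom (.condVar f) _ = _
  rw [evalFrom_var (.condNum f) (.condVar f) rfl (fun q b => by cases f <;> rfl),
    DFA.evalFrom_cons]
  have : (syntaxDFA N).step (.condNum f (N.eval (numeral index e.1)))
      (if f then .kwThen else .kwInWhichCase) = .obl := by
    cases f <;> exact if_pos (eval_mem_accept hN _)
  rw [this, evalFrom_var .oblNum .obl rfl (fun _ _ => rfl)]

theorem evalFrom_unless (hN : N.accepts = Set.range (numeral index)) (l : List (AP × AP))
    (w : List Token) (hw : ∀ p, (syntaxDFA N).evalFrom (.oblNum (N.eval (numeral index p))) w ∈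
      (syntaxDFA N).accept) (p : AP) :
    (syntaxDFA N).evalFrom (.oblNum (N.eval (numeral index p)))
      ((l.flatMap fun e => [.kwUnless, .neg] ++ (encodeFormula index (.var e.1) ++
        (.kwInWhichCase :: encodeFormula index (.var e.2)))) ++ w) ∈ (syntaxDFA N).accept := by
  induction l generalizing p with
  | nil => exact hw p
  | cons e l ih =>
    have : (syntaxDFA N).step (.oblNum (N.eval (numeral index p))) .kwUnless = .cond false :=
      if_pos (eval_mem_accept hN p)
    simp only [List.flatMap_cons, List.cons_append, List.append_assoc, List.nil_append]
    rw [DFA.evalFrom_cons, this]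
    erw [evalFrom_pair hN false e]
    exact ih e.2

theorem evalFrom_instance (hN : N.accepts = Set.range (numeral index))
    (R : List (RuleData AP)) (o : AP) (s : Phase Q)
    (hIf : (syntaxDFA N).step s .kwIf = .cond true)
    (hGoal : (syntaxDFA N).step s .turnstile = .goal) :
    (syntaxDFA N).evalFrom s (encodeInstance index (R.map negPosRule) o) ∈
      (syntaxDFA N).accept := by
  induction R generalizing s with
  | nil =>
    change (syntaxDFA N).evalFrom s (.turnstile :: _) ∈ _
    rw [DFA.evalFrom_cons, hGoal]
    exact evalFrom_goal hN o
  | cons r R ih =>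
    rw [encodeInstance_cons]
    simp only [List.cons_append, List.nil_append]
    rw [DFA.evalFrom_cons, hIf]
    erw [evalFrom_pair hN true r.1]
    exact evalFrom_unless hN r.2 _ (fun p => ih _ (if_pos (eval_mem_accept hN p))
      (if_pos (eval_mem_accept hN p))) _

/-- The syntax check accepts exactly the encodings of instances. -/
theorem mem_accepts_syntaxDFA (hN : N.accepts = Set.range (numeral index)) {w : List Token} :
    w ∈ (syntaxDFA N).accepts ↔
      ∃ (R : List (RuleData AP)) (o : AP), w = encodeInstance index (R.map negPosRule) o := by
  constructor
  · exact fun h => follows_of_accepts hN w .rules h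
  · rintro ⟨R, o, rfl⟩
    exact evalFrom_instance hN R o .rules rfl rfl

end Instances

end SLEEC

namespace SLEEC

open Turing StateTransition

/-! ### The machine -/

/-- The stacks of the machine: the input, two stacks `a` and `b` between which the marked word is
moved back and forth, the stack `c` for the digits of the variable found, which also receives the
output, and an auxiliary stack `d` for comparisons with `c`. -/
inductive Stack where
  | inp
  | a
  | b
  | c
  | d
  deriving DecidableEq

instance : Fintype Stack :=
  ⟨{.inp, .a, .b, .c, .d}, fun k => by cases k <;> decide⟩

/-- The alphabets of the stacks. -/
abbrev Stack.Symbol : Stack → Type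
  | .inp => Token
  | .a => Token × Bool
  | .b => Token × Bool
  | .c => Bool
  | .d => Bool

/-- The loops of the machine. -/
inductive Label where
  | load
  | unload
  | scan
  | mark
  | restore
  | clear
  | finish
  deriving DecidableEq

instance : Fintype Label :=
  ⟨{.load, .unload, .scan, .mark, .restore, .clear, .finish}, fun k => by cases k <;> decide⟩

/-- The finite memory of the machine: the state of the syntax check, the memory of the scan, the
symbols last read, the result so far of a comparison of two numerals, and the answer. -/
structure Reg (Q : Type) where
  syn : Q
  scan : Scan
  tok : Option (Token × Bool)
  bit : Option Bool
  same : Bool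
  ans : Bool
  deriving Fintype

/-- The digit in a marked token. -/
def digit : Option (Token × Bool) → Option Bool
  | some (.bit b, _) => some b
  | _ => none

/-- Whether a marked token is `var`. -/
def isVar : Option (Token × Bool) → Bool
  | some (.var, _) => true
  | _ => false

section Machine

variable {Q : Type} (M : DFA Token Q)

/-- The initial memory. -/
def Reg.init : Reg Q := ⟨M.start, Scan.init, none, none, true, false⟩

open TM2.Stmt in
open Classical in
/-- The program. It checks the syntax with the automaton `M` while it moves the input to `b`
(`load`), and moves it on to `a` (`unload`). Each round scans the word on its way from `a` to `b`
(`scan`). If this finds a new variable, its occurrences are marked on the way back from `b` to `a`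
(`mark`): the digits before each token `var` are compared with those on `c`, which pass to `d`
meanwhile and are then put back (`restore`). When the word is back on `a`, the stack `c` is emptied
(`clear`) for the next round. In the end all stacks are emptied and the answer is written
(`finish`). -/
noncomputable def program : Label → TM2.Stmt Stack.Symbol Label (Reg Q)
  | .load =>
    pop .inp (fun v t => { v with tok := t.map fun t => (t, false) }) <|
    branch (fun v => v.tok.isSome)
      (push .b (fun v => v.tok.getD (.neg, false)) <|
        load (fun v => { v with
          syn := M.step v.syn (v.tok.getD (.neg, false)).1
          tok := none }) <|
        goto fun _ => .load)
      (branch (fun v => decide (v.syn ∈ M.accept))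
        (load (fun _ => Reg.init M) <| goto fun _ => .unload)
        (load (fun _ => Reg.init M) <| goto fun _ => .finish))
  | .unload =>
    pop .b (fun v t => { v with tok := t }) <|
    branch (fun v => v.tok.isSome)
      (push .a (fun v => v.tok.getD (.neg, false)) <|
        load (fun _ => Reg.init M) <| goto fun _ => .unload)
      (goto fun _ => .scan)
  | .scan =>
    pop .a (fun v t => { v with tok := t }) <|
    branch (fun v => v.tok.isSome)
      (push .b (fun v => v.tok.getD (.neg, false)) <|
        branch (fun v => (digit v.tok).isSome && v.scan.copying)
          (push .c (fun v => (digit v.tok).getD false) <|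
            load (fun v => { v with
              scan := v.scan.next (v.tok.getD (.neg, false))
              tok := none }) <|
            goto fun _ => .scan)
          (load (fun v => { v with
              scan := v.scan.next (v.tok.getD (.neg, false))
              tok := none }) <|
            goto fun _ => .scan))
      (branch (fun v => v.scan.contra)
        (load (fun _ => { Reg.init M with ans := true }) <| goto fun _ => .finish)
        (branch (fun v => v.scan.found)
          (load (fun _ => Reg.init M) <| goto fun _ => .mark)
          (load (fun _ => Reg.init M) <| goto fun _ => .finish)))
  | .mark =>
    pop .b (fun v t => { v with tok := t }) <|
    branch (fun v => v.tok.isSome)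
      (branch (fun v => (digit v.tok).isSome)
        (push .a (fun v => v.tok.getD (.neg, false)) <|
          pop .c (fun v x => { v with bit := x }) <|
          branch (fun v => v.bit.isSome)
            (push .d (fun v => v.bit.getD false) <|
              load (fun v => { Reg.init M with same := v.same && v.bit == digit v.tok }) <|
              goto fun _ => .mark)
            (load (fun _ => { Reg.init M with same := false }) <| goto fun _ => .mark))
        (branch (fun v => isVar v.tok)
          (peek .c (fun v x => { v with bit := x }) <|
            push .a (fun v => (.var, v.tok.any Prod.snd || (v.same && v.bit.isNone))) <|
            load (fun _ => Reg.init M) <| goto fun _ => .restore)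
          (push .a (fun v => v.tok.getD (.neg, false)) <|
            load (fun v => { v with tok := none }) <| goto fun _ => .mark)))
      (load (fun _ => Reg.init M) <| goto fun _ => .clear)
  | .restore =>
    pop .d (fun v x => { v with bit := x }) <|
    branch (fun v => v.bit.isSome)
      (push .c (fun v => v.bit.getD false) <|
        load (fun _ => Reg.init M) <| goto fun _ => .restore)
      (goto fun _ => .mark)
  | .clear =>
    pop .c (fun v x => { v with bit := x }) <|
    branch (fun v => v.bit.isSome)
      (load (fun _ => Reg.init M) <| goto fun _ => .clear)
      (goto fun _ => .scan)
  | .finish =>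
    pop .b (fun v t => { v with tok := t }) <|
    pop .c (fun v x => { v with bit := x }) <|
    branch (fun v => v.tok.isSome || v.bit.isSome)
      (load (fun v => { v with tok := none, bit := none }) <| goto fun _ => .finish)
      (push .c (fun v => v.ans) <| load (fun _ => Reg.init M) halt)

/-- The bundled machine. -/
noncomputable def machine [Fintype Q] : FinTM2 where
  K := Stack
  k₀ := .inp
  k₁ := .c
  Γ := Stack.Symbol
  Λ := Label
  main := .load
  σ := Reg Q
  initialState := Reg.init M
  Γk₀Fin := inferInstanceAs (Fintype Token)
  m := program M

/-! ### The loops of the machine -/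

/-- The contents of all stacks. -/
def contents (i : List Token) (a b : List (Token × Bool)) (c d : List Bool) :
    ∀ k : Stack, List k.Symbol
  | .inp => i
  | .a => a
  | .b => b
  | .c => c
  | .d => d

section Stacks

variable (i i' : List Token) (a a' b b' : List (Token × Bool)) (c c' d d' : List Bool)

theorem update_contents_inp :
    Function.update (contents i a b c d) .inp i' = contents i' a b c d := by
  funext k; cases k <;> rfl

theorem update_contents_a :
    Function.update (contents i a b c d) .a a' = contents i a' b c d := by
  funext k; cases k <;> rfl

theorem update_contents_b :
    Function.update (contents i a b c d) .b b' = contents i a b' c d := by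
  funext k; cases k <;> rfl

theorem update_contents_c :
    Function.update (contents i a b c d) .c c' = contents i a b c' d := by
  funext k; cases k <;> rfl

theorem update_contents_d :
    Function.update (contents i a b c d) .d d' = contents i a b c d' := by
  funext k; cases k <;> rfl

end Stacks

/-- A configuration of the machine. -/
def cfg (l : Option Label) (v : Reg Q) (i : List Token) (a b : List (Token × Bool))
    (c d : List Bool) : TM2.Cfg Stack.Symbol Label (Reg Q) :=
  ⟨l, v, contents i a b c d⟩

/-- The machine gets from the configuration `x` to `y` in at most `t` steps. -/
def Within (t : ℕ) (x y : TM2.Cfg Stack.Symbol Label (Reg Q)) : Prop :=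
  Nonempty (EvalsToInTime (TM2.step (program M)) x (some y) t)

variable {M}

theorem Within.refl (x : TM2.Cfg Stack.Symbol Label (Reg Q)) : Within M 0 x x :=
  ⟨EvalsToInTime.refl _ _⟩

theorem Within.trans {s t : ℕ} {x y z : TM2.Cfg Stack.Symbol Label (Reg Q)}
    (h : Within M s x y) (h' : Within M t y z) : Within M (s + t) x z := by
  obtain ⟨h⟩ := h
  obtain ⟨h'⟩ := h'
  rw [add_comm]
  exact ⟨EvalsToInTime.trans _ _ _ _ _ _ h h'⟩

theorem Within.mono {s t : ℕ} {x y : TM2.Cfg Stack.Symbol Label (Reg Q)}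
    (h : Within M s x y) (hst : s ≤ t) : Within M t x y := by
  obtain ⟨h⟩ := h
  exact ⟨⟨h.toEvalsTo, h.steps_le_m.trans hst⟩⟩

theorem within_one {x y : TM2.Cfg Stack.Symbol Label (Reg Q)}
    (h : TM2.step (program M) x = some y) : Within M 1 x y :=
  ⟨⟨⟨1, h⟩, le_rfl⟩⟩

theorem Within.head {t : ℕ} {x y z : TM2.Cfg Stack.Symbol Label (Reg Q)}
    (h : TM2.step (program M) x = some y) (h' : Within M t y z) : Within M (t + 1) x z := by
  rw [add_comm]
  exact (within_one h).trans h'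

theorem within_load (i : List Token) : ∀ (q : Q) (b : List (Token × Bool)),
    Within M i.length (cfg (some .load) { Reg.init M with syn := q } i [] b [] [])
      (cfg (some .load) { Reg.init M with syn := M.evalFrom q i } [] []
        ((i.map fun t => (t, false)).reverse ++ b) [] []) := by
  induction i with
  | nil => exact fun q b => Within.refl _
  | cons t i ih =>
    intro q b
    refine Within.head (y := cfg (some .load) { Reg.init M with syn := M.step q t } i []
      ((t, false) :: b) [] []) ?_ ?_
    · simp [cfg, program, contents, update_contents_inp, update_contents_b, Reg.init]
    · simpa using ih (M.step q t) ((t, false) :: b)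

theorem within_load_accept {q : Q} (hq : q ∈ M.accept) (b : List (Token × Bool)) :
    Within M 1 (cfg (some .load) { Reg.init M with syn := q } [] [] b [] [])
      (cfg (some .unload) (Reg.init M) [] [] b [] []) :=
  within_one (by simp [cfg, program, contents, update_contents_inp, Reg.init, hq])

theorem within_load_reject {q : Q} (hq : q ∉ M.accept) (b : List (Token × Bool)) :
    Within M 1 (cfg (some .load) { Reg.init M with syn := q } [] [] b [] [])
      (cfg (some .finish) (Reg.init M) [] [] b [] []) :=
  within_one (by simp [cfg, program, contents, update_contents_inp, Reg.init, hq])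

theorem within_unload (b : List (Token × Bool)) : ∀ a : List (Token × Bool),
    Within M (b.length + 1) (cfg (some .unload) (Reg.init M) [] a b [] [])
      (cfg (some .scan) (Reg.init M) [] (b.reverse ++ a) [] [] []) := by
  induction b with
  | nil =>
    exact fun a => within_one (by simp [cfg, program, contents, update_contents_b, Reg.init])
  | cons t b ih =>
    intro a
    refine Within.head (y := cfg (some .unload) (Reg.init M) [] (t :: a) b [] []) ?_ ?_
    · simp [cfg, program, contents, update_contents_a, update_contents_b, Reg.init]
    · simpa using ih (t :: a)

theorem within_scan (u : List (Token × Bool)) : ∀ (s : Scan) (b : List (Token × Bool))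
    (c : List Bool),
    Within M u.length (cfg (some .scan) { Reg.init M with scan := s } [] u b c [])
      (cfg (some .scan) { Reg.init M with scan := (u.foldl Scan.step (s, c)).1 } []
        [] (u.reverse ++ b) (u.foldl Scan.step (s, c)).2 []) := by
  induction u with
  | nil => exact fun _ _ _ => Within.refl _
  | cons t u ih =>
    intro s b c
    refine Within.head (y := cfg (some .scan)
      { Reg.init M with scan := (Scan.step (s, c) t).1 } [] u (t :: b)
        (Scan.step (s, c) t).2 []) ?_ ?_
    · obtain ⟨t, m⟩ := t
      cases t with
      | bit x =>
        cases h : s.copying <;>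
          simp [cfg, program, contents, update_contents_a, update_contents_b, update_contents_c,
            Reg.init, Scan.step, digit, h]
      | _ =>
        simp [cfg, program, contents, update_contents_a, update_contents_b, Reg.init, Scan.step,
          digit]
    · simpa using ih (Scan.step (s, c) t).1 (t :: b) (Scan.step (s, c) t).2

theorem within_scan_contra {s : Scan} (hs : s.contra = true) (b : List (Token × Bool))
    (c : List Bool) :
    Within M 1 (cfg (some .scan) { Reg.init M with scan := s } [] [] b c [])
      (cfg (some .finish) { Reg.init M with ans := true } [] [] b c []) :=
  within_one (by simp [cfg, program, contents, update_contents_a, Reg.init, hs])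

theorem within_scan_found {s : Scan} (hs : s.contra = false) (hf : s.found = true)
    (b : List (Token × Bool)) (c : List Bool) :
    Within M 1 (cfg (some .scan) { Reg.init M with scan := s } [] [] b c [])
      (cfg (some .mark) (Reg.init M) [] [] b c []) :=
  within_one (by simp [cfg, program, contents, update_contents_a, Reg.init, hs, hf])

theorem within_scan_none {s : Scan} (hs : s.contra = false) (hf : s.found = false)
    (b : List (Token × Bool)) (c : List Bool) :
    Within M 1 (cfg (some .scan) { Reg.init M with scan := s } [] [] b c [])
      (cfg (some .finish) (Reg.init M) [] [] b c []) :=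
  within_one (by simp [cfg, program, contents, update_contents_a, Reg.init, hs, hf])

theorem within_restore (d : List Bool) : ∀ (a b : List (Token × Bool)) (c : List Bool),
    Within M (d.length + 1) (cfg (some .restore) (Reg.init M) [] a b c d)
      (cfg (some .mark) (Reg.init M) [] a b (d.reverse ++ c) []) := by
  induction d with
  | nil =>
    exact fun a b c => within_one (by simp [cfg, program, contents, update_contents_d, Reg.init])
  | cons x d ih =>
    intro a b c
    refine Within.head (y := cfg (some .restore) (Reg.init M) [] a b (x :: c) d) ?_ ?_
    · simp [cfg, program, contents, update_contents_c, update_contents_d, Reg.init]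
    · simpa using ih a b (x :: c)

theorem within_clear (c : List Bool) (a : List (Token × Bool)) :
    Within M (c.length + 1) (cfg (some .clear) (Reg.init M) [] a [] c [])
      (cfg (some .scan) (Reg.init M) [] a [] [] []) := by
  induction c with
  | nil => exact within_one (by simp [cfg, program, contents, update_contents_c, Reg.init])
  | cons x c ih =>
    refine Within.head (y := cfg (some .clear) (Reg.init M) [] a [] c []) ?_ ih
    simp [cfg, program, contents, update_contents_c, Reg.init]

theorem within_finish (ans : Bool) (b : List (Token × Bool)) : ∀ c : List Bool,
    Within M (b.length + c.length + 1)
      (cfg (some .finish) { Reg.init M with ans := ans } [] [] b c [])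
      (cfg none (Reg.init M) [] [] [] [ans] []) := by
  induction b with
  | nil =>
    intro c
    induction c with
    | nil =>
      exact within_one
        (by simp [cfg, program, contents, update_contents_b, update_contents_c, Reg.init])
    | cons x c ih =>
      refine Within.head
        (y := cfg (some .finish) { Reg.init M with ans := ans } [] [] [] c []) ?_ ih
      simp [cfg, program, contents, update_contents_b, update_contents_c, Reg.init]
  | cons t b ih =>
    intro c
    refine (Within.head (y := cfg (some .finish) { Reg.init M with ans := ans } [] [] b c.tail [])
      ?_ (ih c.tail)).mono (by simp; omega)
    simp [cfg, program, contents, update_contents_b, update_contents_c, Reg.init]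

/-- Reading the digits `x` in `mark` compares them with the top of `c`: nothing is lost, as the
digits of `c` that were used are on `d`, and the comparison has succeeded and `c` is used up if and
only if `x` is all of `c`. -/
theorem within_mark_bits (x : List Bool) : ∀ (e : Bool) (a b : List (Token × Bool))
    (c d : List Bool), ∃ e' c' d',
    Within M x.length
      (cfg (some .mark) { Reg.init M with same := e } [] a
        ((x.map fun y => (Token.bit y, false)) ++ b) c d)
      (cfg (some .mark) { Reg.init M with same := e' } []
        ((x.reverse.map fun y => (Token.bit y, false)) ++ a) b c' d') ∧
      d'.reverse ++ c' = d.reverse ++ c ∧ (e' = true ∧ c' = [] ↔ e = true ∧ x = c) := by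
  induction x with
  | nil =>
    intro e a b c d
    exact ⟨e, c, d, Within.refl _, rfl, by rw [eq_comm (a := c)]⟩
  | cons y x ih =>
    intro e a b c d
    cases c with
    | nil =>
      obtain ⟨e', c', d', h, h1, h2⟩ := ih false ((.bit y, false) :: a) b [] d
      refine ⟨e', c', d', Within.head ?_ (by simpa using h), h1, by simpa using h2⟩
      simp [cfg, program, contents, update_contents_a, update_contents_b, update_contents_c,
        Reg.init, digit]
    | cons z c =>
      obtain ⟨e', c', d', h, h1, h2⟩ := ih (e && z == y) ((.bit y, false) :: a) b c (z :: d)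
      refine ⟨e', c', d', Within.head ?_ (by simpa using h), by simpa using h1, h2.trans ?_⟩
      · simp [cfg, program, contents, update_contents_a, update_contents_b, update_contents_c,
          update_contents_d, Reg.init, digit]
      · simp only [Bool.and_eq_true, beq_iff_eq, List.cons.injEq]
        tauto

theorem within_mark_var (e m : Bool) (a b : List (Token × Bool)) (c d : List Bool) :
    Within M 1 (cfg (some .mark) { Reg.init M with same := e } [] a ((.var, m) :: b) c d)
      (cfg (some .restore) (Reg.init M) [] ((.var, m || (e && c.isEmpty)) :: a) b c d) :=
  within_one (by
    cases c <;>
      simp [cfg, program, contents, update_contents_a, update_contents_b, Reg.init, digit, isVar])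

theorem within_mark_end (a : List (Token × Bool)) (c : List Bool) :
    Within M 1 (cfg (some .mark) (Reg.init M) [] a [] c [])
      (cfg (some .clear) (Reg.init M) [] a [] c []) :=
  within_one (by simp [cfg, program, contents, update_contents_b, Reg.init])

variable (M) in
/-- When `c` holds the numeral to look for, the loop `mark` turns the part `u` of the word into
`u'`. -/
def MarksTo (c : List Bool) (u u' : List (Token × Bool)) : Prop :=
  ∀ a b, Within M ((c.length + 2) * u.length)
    (cfg (some .mark) (Reg.init M) [] a (u.reverse ++ b) c [])
    (cfg (some .mark) (Reg.init M) [] (u' ++ a) b c [])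

theorem MarksTo.append {c : List Bool} {u u' w w' : List (Token × Bool)}
    (hu : MarksTo M c u u') (hw : MarksTo M c w w') : MarksTo M c (u ++ w) (u' ++ w') := by
  intro a b
  rw [List.length_append, mul_add, add_comm, List.reverse_append, List.append_assoc,
    List.append_assoc]
  exact (hw a _).trans (hu _ b)

theorem MarksTo.flatMap {α : Type*} {c : List Bool} {f f' : α → List (Token × Bool)}
    (h : ∀ x, MarksTo M c (f x) (f' x)) (l : List α) :
    MarksTo M c (l.flatMap f) (l.flatMap f') := by
  induction l with
  | nil => exact fun a b => Within.refl _
  | cons x l ih =>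
    rw [List.flatMap_cons, List.flatMap_cons]
    exact (h x).append ih

theorem marksTo_token (c : List Bool) {t : Token} (hv : t ≠ .var) (hb : ∀ b, t ≠ .bit b) :
    MarksTo M c [(t, false)] [(t, false)] := by
  intro a b
  refine (within_one ?_).mono (s := 1) (by simp)
  cases t with
  | bit b => exact absurd rfl (hb b)
  | var => exact absurd rfl hv
  | _ => simp [cfg, program, contents, update_contents_a, update_contents_b, Reg.init, digit, isVar]

variable {AP : Type*} {index : AP → ℕ} [DecidableEq AP]

theorem marksTo_var (hindex : Function.Injective index) (F : Finset AP) (p q : AP) :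
    MarksTo M (numeral index p).reverse (markedVar index (fun x => decide (x ∈ F)) q)
      (markedVar index (fun x => decide (x ∈ insert p F)) q) := by
  intro a b
  obtain ⟨e', c', d', h, h1, h2⟩ := within_mark_bits (M := M) (numeral index q).reverse true a
    ((.var, decide (q ∈ F)) :: b) (numeral index p).reverse []
  have hmark : (decide (q ∈ F) || (e' && c'.isEmpty)) = decide (q ∈ insert p F) := by
    have : (e' && c'.isEmpty) = decide (q = p) := by
      rw [Bool.eq_iff_iff, Bool.and_eq_true, List.isEmpty_iff, h2, decide_eq_true_iff,
        List.reverse_inj]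
      simp [(numeral_injective index hindex).eq_iff]
    rw [this, Bool.eq_iff_iff]
    simp [or_comm]
  have h3 := within_mark_var (M := M) e' (decide (q ∈ F))
    (((numeral index q).reverse.reverse.map fun y => (Token.bit y, false)) ++ a) b c' d'
  have h4 := within_restore (M := M) d' ((.var, decide (q ∈ F) || (e' && c'.isEmpty)) ::
    (((numeral index q).reverse.reverse.map fun y => (Token.bit y, false)) ++ a)) b c'
  have hd : d'.length ≤ (numeral index p).reverse.length := by
    have := congrArg List.length h1
    simp at this ⊢
    omega
  rw [h1, hmark] at h4
  rw [hmark] at h3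
  have := h.trans (h3.trans h4)
  simp only [List.reverse_reverse, List.reverse_nil, List.nil_append] at this
  simp only [markedVar, List.reverse_cons, List.append_assoc, List.cons_append, List.nil_append,
    ← List.map_reverse]
  refine this.mono ?_
  simp only [List.length_reverse, List.length_cons, List.length_map] at hd ⊢
  nlinarith

/-- The loop `mark` adds the variable on the stack `c` to the set of marked variables. -/
theorem marksTo_instance (hindex : Function.Injective index) (F : Finset AP) (p : AP)
    (R : List (RuleData AP)) (o : AP) :
    MarksTo M (numeral index p).reverse (markedInstance index (fun x => decide (x ∈ F)) R o)
      (markedInstance index (fun x => decide (x ∈ insert p F)) R o) := by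
  have hpair : ∀ k₁ k₂ : Token, k₁ ≠ .var → (∀ b, k₁ ≠ .bit b) → k₂ ≠ .var → (∀ b, k₂ ≠ .bit b) →
      ∀ e, MarksTo M (numeral index p).reverse
        (markedPair index (fun x => decide (x ∈ F)) k₁ k₂ e)
        (markedPair index (fun x => decide (x ∈ insert p F)) k₁ k₂ e) := by
    intro k₁ k₂ h1 h2 h3 h4 e
    exact ((((marksTo_token _ h1 h2).append (marksTo_token _ (by simp) (by simp))).append
      (marksTo_var hindex F p e.1)).append (marksTo_token _ h3 h4)).append
      (marksTo_var hindex F p e.2)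
  refine (MarksTo.flatMap (fun r => ?_) R).append
    ((marksTo_token _ (by simp) (by simp)).append (marksTo_var hindex F p o))
  exact (hpair _ _ (by simp) (by simp) (by simp) (by simp) r.1).append
    (MarksTo.flatMap (hpair _ _ (by simp) (by simp) (by simp) (by simp)) r.2)

end Machine

end SLEEC

namespace SLEEC

open Turing StateTransition

/-! ### Correctness and running time -/

section Correctness

variable {AP : Type*} {index : AP → ℕ}

theorem rulesEntail_map_negPosRule {R : List (RuleData AP)} {o : AP} :
    RulesEntail (R.map negPosRule) (.var o) ↔
      ∀ v : AP → Bool, (∀ r ∈ R, (negPosRule r).compile.eval v = true) → v o = true := by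
  simp only [RulesEntail, Entails, Set.mem_ofPred_eq, Formula.eval]
  refine forall_congr' fun v => imp_congr_left ⟨fun h r hr => ?_, ?_⟩
  · exact h _ ⟨_, List.mem_map_of_mem hr, rfl⟩
  · rintro h _ ⟨σ, hσ, rfl⟩
    obtain ⟨r, hr, rfl⟩ := List.mem_map.1 hσ
    exact h r hr

theorem mem_negPosEntailment {w : List Token} :
    w ∈ negPosEntailment index ↔ ∃ (R : List (RuleData AP)) (o : AP),
      w = encodeInstance index (R.map negPosRule) o ∧
        RulesEntail (R.map negPosRule) (.var o) := by
  constructor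
  · rintro ⟨Γ, o, hΓ, h, rfl⟩
    obtain ⟨R, rfl⟩ := exists_map_negPosRule hΓ
    exact ⟨R, o, rfl, h⟩
  · rintro ⟨R, o, rfl, h⟩
    refine ⟨_, o, fun σ hσ => ?_, h, rfl⟩
    obtain ⟨r, -, rfl⟩ := List.mem_map.1 hσ
    exact isNegPos_negPosRule r

theorem length_foldl_step_le (u : List (Token × Bool)) (x : Scan × List Bool) :
    (u.foldl Scan.step x).2.length ≤ x.2.length + u.length := by
  induction u generalizing x with
  | nil => simp
  | cons t u ih =>
    refine (ih _).trans ?_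
    have : (Scan.step x t).2.length ≤ x.2.length + 1 := by
      obtain ⟨t, m⟩ := t
      cases t <;> simp only [Scan.step] <;> try split_ifs
      all_goals simp
    rw [List.length_cons]
    omega

variable {Q : Type} {M : DFA Token Q} [DecidableEq AP]

open Classical in
/-- If every variable of `F` is false in all models of the rules in which the goal is false, then
the rounds that start with the marks of `F` lead to the correct answer. Each round makes the set of
unmarked candidates, which has `k` elements, smaller. -/
theorem within_rounds (hindex : Function.Injective index) (R : List (RuleData AP)) (o : AP) {n : ℕ}
    (hn : (encodeInstance index (R.map negPosRule) o).length = n) (k : ℕ) :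
    ∀ F : Finset AP, ((Search.candidates R o).toFinset \ F).card ≤ k →
      (∀ v : AP → Bool, (∀ r ∈ R, (negPosRule r).compile.eval v = true) → v o = false →
        ∀ p ∈ F, v p = false) →
      Within M (k * ((n + 1) * (n + 3)) + (3 * n + 2))
        (cfg (some .scan) (Reg.init M) []
          (markedInstance index (fun x => decide (x ∈ F)) R o) [] [] [])
        (cfg none (Reg.init M) [] [] []
          [decide (RulesEntail (R.map negPosRule) (.var o))] []) := by
  induction k with
  | zero | succ k ih =>
    intro F hk hF
    set u := markedInstance index (fun x => decide (x ∈ F)) R o with hu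
    have hlen : u.length = n := by
      rw [← hn, ← map_fst_markedInstance index fun x => decide (x ∈ F), List.length_map]
    have hscan := within_scan (M := M) u Scan.init [] []
    obtain ⟨h1, h2, -, -, h5⟩ := Scan.tracks_run (index := index) (F := fun x => decide (x ∈ F)) R o
    have hc := length_foldl_step_le u (Scan.init, [])
    rw [← hu] at h1 h2 h5
    set x := u.foldl Scan.step (Scan.init, [])
    set A := Search.run (fun x => decide (x ∈ F)) R o with hA
    rw [List.append_nil] at hscan
    simp only [List.length_nil, zero_add] at hc
    have hsound : ∀ v : AP → Bool, (∀ r ∈ R, (negPosRule r).compile.eval v = true) →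
        v o = false → A.Sound (fun x => decide (x ∈ F)) v := fun v hv ho =>
      Search.sound_run (fun p hp => hF v hv ho p (by simpa using hp)) hv ho
    have hfin : ∀ ans : Bool, Within M (2 * n + 1)
        (cfg (some .finish) { Reg.init M with ans := ans } [] [] u.reverse x.2 [])
        (cfg none (Reg.init M) [] [] [] [ans] []) := fun ans =>
      (within_finish ans u.reverse x.2).mono (by rw [List.length_reverse]; omega)
    cases hcontra : A.contra with
    | true =>
      have hent : RulesEntail (R.map negPosRule) (.var o) := by
        rw [rulesEntail_map_negPosRule]
        intro v hv
        by_contra ho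
        have := (hsound v hv (by simpa using ho)).2
        rw [hcontra] at this
        cases this
      rw [decide_eq_true hent]
      exact (hscan.trans ((within_scan_contra (h2.trans hcontra) _ _).trans (hfin true))).mono
        (by omega)
    | false =>
      cases hfound : A.found with
      | none =>
        have hent : ¬ RulesEntail (R.map negPosRule) (.var o) := by
          rw [rulesEntail_map_negPosRule]
          intro h
          obtain ⟨h3, h4⟩ := Search.complete_run hfound hcontra
          have := h _ h3
          rw [h4] at this
          cases this
        rw [decide_eq_false hent]
        exact (hscan.trans ((within_scan_none (h2.trans hcontra)
          (h1.trans (by rw [hfound]; rfl)) _ _).trans (hfin false))).mono (by omega)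
      | some p =>
        have hp := Search.run_found_mem (hA ▸ hfound)
        have hpF : p ∉ F := by simpa using hp.2
        have hpos : p ∈ (Search.candidates R o).toFinset \ F := by simp [hp.1, hpF]
        -- For `k = 0` there is no unmarked candidate left that could be found.
        first
          | exact absurd hk (Nat.not_le.2 (Finset.card_pos.2 ⟨p, hpos⟩))
          | have hcp : x.2 = (numeral index p).reverse := by rw [h5, hfound]; rfl
            have hk' : ((Search.candidates R o).toFinset \ insert p F).card ≤ k := by
              rw [Finset.sdiff_insert, Finset.card_erase_of_mem hpos]
              omega
            have hF' : ∀ v : AP → Bool, (∀ r ∈ R, (negPosRule r).compile.eval v = true) →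
                v o = false → ∀ q ∈ insert p F, v q = false := by
              intro v hv ho q hq
              rcases Finset.mem_insert.1 hq with rfl | hq
              · exact ((hsound v hv ho).1 q hfound).2
              · exact hF v hv ho q hq
            have hmark := marksTo_instance (M := M) hindex F p R o [] []
            rw [← hcp, ← hu, List.append_nil, List.append_nil] at hmark
            refine (hscan.trans ((within_scan_found (h2.trans hcontra)
              (h1.trans (by rw [hfound]; rfl)) _ _).trans (hmark.trans ((within_mark_end _ _).trans
              ((within_clear _ _).trans (ih _ hk' hF')))))).mono ?_
            rw [hlen] at hc ⊢
            have := Nat.mul_le_mul_right n (Nat.add_le_add_right hc 2)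
            nlinarith

open Classical in
/-- The machine decides the entailment problem, provided that `M` checks the syntax. -/
theorem within_main (hindex : Function.Injective index)
    (hM : ∀ w, w ∈ M.accepts ↔
      ∃ (R : List (RuleData AP)) (o : AP), w = encodeInstance index (R.map negPosRule) o)
    (w : List Token) :
    Within M (w.length * ((w.length + 1) * (w.length + 3)) + 5 * w.length + 4)
      (cfg (some .load) (Reg.init M) w [] [] [] [])
      (cfg none (Reg.init M) [] [] [] [decide (w ∈ negPosEntailment index)] []) := by
  have hload := within_load (M := M) w M.start []
  rw [List.append_nil] at hload
  by_cases hw : M.evalFrom M.start w ∈ M.accept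
  · -- A parse of `w` is chosen that entails its goal if possible, so that unique readability of
    -- the encoding is not needed.
    obtain ⟨R, o, rfl, hent⟩ : ∃ (R : List (RuleData AP)) (o : AP),
        w = encodeInstance index (R.map negPosRule) o ∧
          (w ∈ negPosEntailment index ↔ RulesEntail (R.map negPosRule) (.var o)) := by
      by_cases hL : w ∈ negPosEntailment index
      · obtain ⟨R, o, h, h'⟩ := mem_negPosEntailment.1 hL
        exact ⟨R, o, h, iff_of_true hL h'⟩
      · obtain ⟨R, o, h⟩ := (hM w).1 hw
        exact ⟨R, o, h, iff_of_false hL fun h' => hL (mem_negPosEntailment.2 ⟨R, o, h, h'⟩)⟩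
    have hunload := within_unload (M := M)
      ((encodeInstance index (R.map negPosRule) o).map fun t => (t, false)).reverse []
    rw [List.append_nil, List.reverse_reverse, ← markedInstance_false] at hunload
    have hrounds := within_rounds (M := M) hindex R o rfl
      (encodeInstance index (R.map negPosRule) o).length ∅
      ((Finset.card_le_card Finset.sdiff_subset).trans ((List.toFinset_card_le _).trans
        (length_candidates_le index R o))) (by simp)
    simp only [Finset.notMem_empty, decide_false] at hrounds
    rw [← markedInstance_false] at hload
    simp only [hent]
    refine (hload.trans ((within_load_accept hw _).trans (hunload.trans hrounds))).mono ?_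
    rw [List.length_reverse, markedInstance_false, List.length_map]
    omega
  · have hL : w ∉ negPosEntailment index := fun hL => by
      obtain ⟨R, o, h, -⟩ := mem_negPosEntailment.1 hL
      exact hw ((hM w).2 ⟨R, o, h⟩)
    rw [decide_eq_false hL]
    refine (hload.trans ((within_load_reject hw _).trans (within_finish false _ []))).mono ?_
    simp only [List.length_reverse, List.length_map, List.length_nil]
    omega

end Correctness

theorem initList_machine {Q : Type} [Fintype Q] (M : DFA Token Q) (w : List Token) :
    initList (machine M) w = cfg (some .load) (Reg.init M) w [] [] [] [] := by
  refine congrArg (TM2.Cfg.mk _ _) ?_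
  funext k
  cases k <;> rfl

theorem haltList_machine {Q : Type} [Fintype Q] (M : DFA Token Q) (l : List Bool) :
    haltList (machine M) l = cfg none (Reg.init M) [] [] [] l [] := by
  refine congrArg (TM2.Cfg.mk _ _) ?_
  funext k
  cases k <;> rfl

end SLEEC

theorem mainTheorem2 {AP : Type*} (index : AP → ℕ) (hindex : Function.Injective index)
    (hsegment : IsLowerSet (Set.range index)) :
    SLEEC.negPosEntailment index ∈ SLEEC.PTIME SLEEC.Token := by
  classical
  obtain ⟨Q, _, N, hN⟩ := SLEEC.isRegular_range_numeral index hsegment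
  have hmain := SLEEC.within_main (M := SLEEC.syntaxDFA N) hindex
    fun w => SLEEC.mem_accepts_syntaxDFA hN
  refine ⟨fun w => decide (w ∈ SLEEC.negPosEntailment index), fun w => decide_eq_true_iff, ⟨?_⟩⟩
  refine
    { tm := SLEEC.machine (SLEEC.syntaxDFA N)
      inputAlphabet := Equiv.refl _
      outputAlphabet := Equiv.refl _
      time := .X * ((.X + 1) * (.X + 3)) + 5 * .X + 4
      outputsFun := fun w => Classical.choice ?_ }
  have htime : (.X * ((.X + 1) * (.X + 3)) + 5 * .X + 4 : Polynomial ℕ).eval w.length =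
      w.length * ((w.length + 1) * (w.length + 3)) + 5 * w.length + 4 := by
    simp
  have hin : w.map (Equiv.refl SLEEC.Token).invFun = w := List.map_id w
  have h := hmain w
  rw [← SLEEC.initList_machine, ← SLEEC.haltList_machine, ← htime] at h
  have key : ∀ w' : List SLEEC.Token, w' = w →
      Nonempty (Turing.TM2OutputsInTime (SLEEC.machine (SLEEC.syntaxDFA N)) w'
        (some [decide (w ∈ SLEEC.negPosEntailment index)])
        ((.X * ((.X + 1) * (.X + 3)) + 5 * .X + 4 : Polynomial ℕ).eval w.length)) := by
    rintro _ rfl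
    exact h
  exact key _ hin
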